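/- Let $M$ be a compact (connected) smooth Riemannian manifold without boundary, with distance $d$, and let $k\ge 1$. Write $S^1=\mathbb R/2\pi\mathbb Z$ and read the indices of points of $M^k$ modulo $k$. \textbf{Definitions.} A \emph{closed geodesic} is a nonconstant smooth curve $\gamma\colon S^1\to M$ satisfying the geodesic equation; $l(\gamma)$ is its length. It is a \emph{$1/k$-geodesic} if $d(\gamma(t),\gamma(t+2\pi/k))=l(\gamma)/k$ for all $t\in S^1$. For $t\in S^1$ put $\bar\gamma(t)=(\gamma(t),\gamma(t+2\pi/k),\dots,\gamma(t+2\pi(k-1)/k))\in M^k$. The \emph{uniform energy} is $E(x_1,\dots,x_k)=\sum_{i=1}^k \frac{d(x_i,x_{i+1})^2}{1/k}$. For $p,q\in M$ let $\widehat{qp}\subset T_qM$ be the set of initial velocity vectors of unit-speed minimizing geodesics from $q$ to $p$. A point $\bar x\in M^k$ is \emph{balanced} if, for every $i$, $d(x_{i-1},x_i)=d(x_i,x_{i+1})$ and there is $\xi_i\in T_{x_i}M$ with $\xi_i\in\widehat{x_ix_{i+1}}$ and $-\xi_i\in\widehat{x_ix_{i-1}}$. A closed geodesic $\gamma$ is \emph{associated}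 to $\bar x$ if for some $t\in S^1$ we have $\bar x=\bar\gamma(t)$ and, for every $i$, the normalized velocity $v_i=\dot\gamma/|\dot\gamma|$ at $t+2\pi(i-1)/k$ satisfies $v_i\in\widehat{x_ix_{i+1}}$ and $-v_i\in\widehat{x_ix_{i-1}}$. A \emph{class of balanced points} is a set of the form $C(\gamma)=\{\bar\gamma(t):t\in S^1\}$, where $\gamma$ is a closed geodesic such that, for every $t\in S^1$, $\bar\gamma(t)$ is a balanced point to which $\gamma$ is associated. It has \emph{nonzero energy} if $E\neq 0$ at all of its points. Call two closed curves $\gamma,\sigma\colon S^1\to M$ \emph{the same} if $\sigma(t)=\gamma(t+c)$ for some constant $c$ and all $t$ (change of base point), or if $\gamma$ is periodic with period $4\pi/k$ and $\sigma(t)=\gamma(c-t)$ for some constant $c$ and all $t$. (For $k=2$ every closed curve has period $4\pi/k=2\pi$, so half-geodesics are taken without orientation.) This is an equivalence relation, and $C(\gamma)$ depends only on the equivalence class of $\gamma$. \textbf{Theorem.} For every $1/k$-geodesic $\gamma$ and every $t\in S^1$, the point $\bar\gamma(t)$ is a balanced point of the uniform energy to which $\gamma$ is associated. The map $\gamma\mapsto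 C(\gamma)$ induces a bijection from the set of $1/k$-geodesics in $M$, modulo the above identification, onto the set of classes of balanced points of the uniform energy in $M^k$ of nonzero energy. That is: $C(\gamma)$ is such a class for every $1/k$-geodesic $\gamma$; every such class is $C(\gamma)$ for some $1/k$-geodesic $\gamma$; and two $1/k$-geodesics $\gamma,\sigma$ satisfy $C(\gamma)=C(\sigma)$ if and only if they are the same in the above sense. -/

import Mathlib

open Set Bundle Manifold
open scoped ContDiff

noncomputable section

section Geodesics

variable {E : Type*} [NormedAddCommGroup E] [NormedSpace ℝ E]
  {M : Type*} [MetricSpace M] [ChartedSpace E M]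
  [RiemannianBundle (fun x : M => TangentSpace 𝓘(ℝ, E) x)]

/-- The coefficient `g_y(v, w)` of the Riemannian metric at the point `y` of the coordinate domain
of the chart at `p`, for coordinate vectors `v`, `w`. -/
def chartMetric (p : M) (y v w : E) : ℝ :=
  inner ℝ
    (mfderiv 𝓘(ℝ, E) 𝓘(ℝ, E) (chartAt E p).symm y v : TangentSpace 𝓘(ℝ, E) ((chartAt E p).symm y))
    (mfderiv 𝓘(ℝ, E) 𝓘(ℝ, E) (chartAt E p).symm y w : TangentSpace 𝓘(ℝ, E) ((chartAt E p).symm y))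

/-- The Christoffel symbol of the first kind in the chart at `p`, contracted with coordinate
vectors: `Γ(a, b; w) = (∂_a g(b, w) + ∂_b g(a, w) - ∂_w g(a, b)) / 2`. -/
def chartChristoffel (p : M) (y a b w : E) : ℝ :=
  (fderiv ℝ (fun z => chartMetric p z b w) y a + fderiv ℝ (fun z => chartMetric p z a w) y b
    - fderiv ℝ (fun z => chartMetric p z a b) y w) / 2

variable (E) in
/-- The velocity vector of a curve. -/
def velocity (γ : ℝ → M) (t : ℝ) : TangentSpace 𝓘(ℝ, E) (γ t) :=
  mfderiv 𝓘(ℝ, ℝ) 𝓘(ℝ, E) γ t (1 : ℝ)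

variable (E) in
/-- A geodesic defined on the whole line: a smooth curve which satisfies the geodesic equation
`g(u'', w) + Γ(u', u'; w) = 0` for all `w` (that is, `∇_{u'} u' = 0`) in every chart `chartAt p`
that it meets, where `u` is the coordinate expression of the curve. -/
def IsGeodesic (γ : ℝ → M) : Prop :=
  ContMDiff 𝓘(ℝ, ℝ) 𝓘(ℝ, E) ∞ γ ∧
  ∀ (p : M) (t : ℝ), γ t ∈ (chartAt E p).source →
    let u : ℝ → E := fun s => chartAt E p (γ s)
    ∀ w : E, chartMetric p (u t) (deriv (deriv u) t) w
      + chartChristoffel p (u t) (deriv u t) (deriv u t) w = 0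

variable (E) in
/-- A closed geodesic `S¹ = ℝ / 2πℤ → M`, as a `2π`-periodic nonconstant geodesic on the line. -/
def IsClosedGeodesic (γ : ℝ → M) : Prop :=
  IsGeodesic E γ ∧ Function.Periodic γ (2 * Real.pi) ∧ ∃ s t, γ s ≠ γ t

variable (E) in
/-- The length of a closed curve parametrized by `[0, 2π]`. -/
def closedLength (γ : ℝ → M) : ℝ :=
  (pathELength 𝓘(ℝ, E) γ 0 (2 * Real.pi)).toReal

variable (E) in
/-- A `1/k`-geodesic: a closed geodesic with `d(γ(t), γ(t + 2π/k)) = l(γ)/k` for all `t`. -/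
def IsOneOverKGeodesic (k : ℕ) (γ : ℝ → M) : Prop :=
  IsClosedGeodesic E γ ∧
    ∀ t, dist (γ t) (γ (t + 2 * Real.pi / k)) = closedLength E γ / k

variable (E) in
/-- The initial velocity vectors at `q` of the unit-speed minimizing geodesics joining `q` to `p`.
A unit-speed geodesic from `q` to `p` is minimizing if and only if it reaches `p` at time
`dist q p`. Since the manifolds considered are complete, geodesics are taken on the whole line.
The last clause says that `σ 0 = q` and that the velocity of `σ` there is `ξ`. -/
def minimizingDirections (q p : M) : Set (TangentSpace 𝓘(ℝ, E) q) :=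
  {ξ | ∃ σ : ℝ → M, IsGeodesic E σ ∧ (∀ s, ‖velocity E σ s‖ = 1) ∧ σ (dist q p) = p ∧
    (⟨σ 0, velocity E σ 0⟩ : TangentBundle 𝓘(ℝ, E) M) = ⟨q, ξ⟩}

/-- The uniform energy on `M^k`; indices are cyclic, since addition in `Fin k` is modulo `k`. -/
def uniformEnergy {k : ℕ} [NeZero k] (x : Fin k → M) : ℝ :=
  ∑ i, dist (x i) (x (i + 1)) ^ 2 / (1 / (k : ℝ))

variable (E) in
/-- Balanced points of the uniform energy. -/
def IsBalanced {k : ℕ} [NeZero k] (x : Fin k → M) : Prop :=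
  (∀ i, dist (x (i - 1)) (x i) = dist (x i) (x (i + 1))) ∧
  ∃ ξ : ∀ i, TangentSpace 𝓘(ℝ, E) (x i), ∀ i,
    ξ i ∈ minimizingDirections E (x i) (x (i + 1)) ∧
    -ξ i ∈ minimizingDirections E (x i) (x (i - 1))

/-- The tuple `(γ(t), γ(t + 2π/k), …, γ(t + 2π(k-1)/k))`. -/
def evenTuple (k : ℕ) (γ : ℝ → M) (t : ℝ) : Fin k → M :=
  fun i => γ (t + 2 * Real.pi * (i : ℕ) / k)

variable (E) in
/-- The normalized velocity of a curve, a unit vector wherever the velocity is not zero. -/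
def direction (γ : ℝ → M) (t : ℝ) : TangentSpace 𝓘(ℝ, E) (γ t) :=
  ‖velocity E γ t‖⁻¹ • velocity E γ t

variable (E) in
/-- The closed geodesic `γ` is associated to the point `x`. A closed geodesic on `ℝ / 2πℤ` has
speed `l(γ) / 2π`, so its velocity is normalized before it is compared with unit vectors. -/
def IsAssociated {k : ℕ} [NeZero k] (γ : ℝ → M) (x : Fin k → M) : Prop :=
  IsClosedGeodesic E γ ∧ ∃ t, x = evenTuple k γ t ∧ ∀ i : Fin k,
    direction E γ (t + 2 * Real.pi * (i : ℕ) / k) ∈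
      minimizingDirections E (evenTuple k γ t i) (evenTuple k γ t (i + 1)) ∧
    -direction E γ (t + 2 * Real.pi * (i : ℕ) / k) ∈
      minimizingDirections E (evenTuple k γ t i) (evenTuple k γ t (i - 1))

variable (E) in
/-- Every evenly spaced tuple on the closed geodesic `γ` is a balanced point with associated closed
geodesic `γ`. -/
def IsRotatingGeodesic (k : ℕ) [NeZero k] (γ : ℝ → M) : Prop :=
  IsClosedGeodesic E γ ∧
    ∀ t, IsBalanced E (evenTuple k γ t) ∧ IsAssociated E γ (evenTuple k γ t)

/-- The set of all evenly spaced `k`-tuples on a curve. -/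
def tupleSet (k : ℕ) (γ : ℝ → M) : Set (Fin k → M) := Set.range (evenTuple k γ)

variable (E) in
/-- Classes of balanced points of the uniform energy in `M^k`. -/
def IsBalancedClass (k : ℕ) [NeZero k] (A : Set (Fin k → M)) : Prop :=
  ∃ γ : ℝ → M, IsRotatingGeodesic E k γ ∧ A = tupleSet k γ

end Geodesics

section Identification

variable {M : Type*}

/-- Identification of closed curves on `ℝ / 2πℤ`: two curves are the same if they differ by a
change of base point; for the curves with period `4π/k` the orientation is disregarded too. -/
def SameCurve (k : ℕ) (γ σ : ℝ → M) : Prop :=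
  (∃ c, ∀ t, σ t = γ (t + c)) ∨
  (Function.Periodic γ (4 * Real.pi / k) ∧ ∃ c, ∀ t, σ t = γ (c - t))

theorem sameCurve_equivalence (k : ℕ) : Equivalence (SameCurve (M := M) k) where
  refl γ := Or.inl ⟨0, fun t => by simp⟩
  symm := by
    rintro γ σ (⟨c, h⟩ | ⟨hp, c, h⟩)
    · exact Or.inl ⟨-c, fun t => by simp [h]⟩
    · refine Or.inr ⟨fun t => ?_, c, fun t => by simp [h]⟩
      rw [h, h, ← hp]
      congr 1
      ring
  trans := by
    rintro γ σ τ (⟨c, h⟩ | ⟨hp, c, h⟩) (⟨d, h'⟩ | ⟨hp', d, h'⟩)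
    · exact Or.inl ⟨d + c, fun t => by rw [h', h, add_assoc]⟩
    · refine Or.inr ⟨fun t => ?_, d + c, fun t => by rw [h', h]; congr 1; ring⟩
      have := hp' (t - c)
      rw [h, h] at this
      rw [show t + 4 * Real.pi / k = t - c + 4 * Real.pi / k + c by ring, this, sub_add_cancel]
    · exact Or.inr ⟨hp, c - d, fun t => by rw [h', h]; congr 1; ring⟩
    · exact Or.inl ⟨c - d, fun t => by rw [h', h]; congr 1; ring⟩

/-- The setoid of `SameCurve`. -/
def curveSetoid (k : ℕ) (M : Type*) : Setoid (ℝ → M) := ⟨SameCurve k, sameCurve_equivalence k⟩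

end Identification

theorem tupleSet_subset_of_sameCurve {M : Type*} [MetricSpace M] (k : ℕ) {γ σ : ℝ → M}
    (h : SameCurve k γ σ) : tupleSet k σ ⊆ tupleSet k γ := by
  rintro _ ⟨t, rfl⟩
  obtain ⟨c, h⟩ | ⟨hp, c, h⟩ := h
  · refine ⟨t + c, funext fun i => ?_⟩
    simp only [evenTuple, h]
    congr 1
    ring
  · refine ⟨c - t, funext fun i => ?_⟩
    simp only [evenTuple, h]
    rw [← hp.nat_mul (i : ℕ) (c - (t + 2 * Real.pi * (i : ℕ) / k))]
    congr 1
    ring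

/-- The set of evenly spaced `k`-tuples on a curve depends only on the curve up to `SameCurve`. -/
def curveTupleSet (k : ℕ) {M : Type*} [MetricSpace M] :
    Quotient (curveSetoid k M) → Set (Fin k → M) :=
  Quotient.lift (tupleSet k) fun _ _ h =>
    Subset.antisymm (tupleSet_subset_of_sameCurve k ((sameCurve_equivalence k).symm h)) (tupleSet_subset_of_sameCurve k h)

end

/-!
A unit vector at `γ t` along a closed geodesic `γ` points along a minimizing geodesic to `p` exactly
when `γ` itself reaches `p` at the distance of `γ t` and `p`. This is uniqueness of geodesics
(`IsGeodesic.eq_of_velocityLift_eq`), and it turns balancedness and association into equations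
between values of `γ`. For a `1/k`-geodesic these equations hold by definition, so it gives a class
of balanced points.

For the converse and for injectivity one only knows that the tuples of two curves (or of one curve
at two times) agree as points of `M^k`, perhaps at different parameters. The tool is
`IsGeodesic.countable_transverse`: two geodesics of the same speed meet at isolated pairs of times
unless they are tangent, and then they agree up to a translation or a reflection of time. So
outside a countable set of times every intersection is of the latter kind; in particular a closed
geodesic, which cannot turn back, generically passes through the same point only after a period.

Let `γ` be a closed geodesic of speed `v` associated to all of its evenly spaced tuples, and let
`d(t)` be the distance of `γ t` and `γ (t + 2π / k)`. Association gives
`γ (t + d(t) / v) = γ (t + 2π / k)` for generic `t`, so that `d(t) / v - 2π / k` is a period for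
generic `t`, hence for all `t` by continuity. A continuous family of periods is constant, so `d` is
a constant `v δ`, and `δ > 0` if the energy is not zero. Then `δ` and `2π / k` agree up to a period,
and `t ↦ γ (k δ t / 2π)` is a closed `1/k`-geodesic with the same tuples.

If two `1/k`-geodesics `γ`, `σ` have the same tuples, they have the same speed, and generically
their meetings are tangent. Either some tangency exhibits `σ` as a translate of `γ`, or
`σ (s + x) = γ (t - x)` for generic `t`; comparing the second entries of the tuples then gives
`γ (t + 2π / k) = γ (t - 2π / k)`, which is the period `4π / k` of the identification.
-/

open Filter Topology

-- Norms on spaces of bilinear maps are found only with nested instance problems of this depth.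
set_option maxSynthPendingDepth 3

/-! ### The geodesic equation in a chart -/

section GeodesicField

variable {E : Type*} [NormedAddCommGroup E] [NormedSpace ℝ E]

/-- The functional `w ↦ -Γ(v, v; w)` at `z = (y, v)` for the Christoffel symbol of the first kind of
the field `A` of bilinear forms; it is the force term of the geodesic equation. Partial derivatives
in `y` are written as derivatives on `E × E` in the direction of the first factor. -/
noncomputable def geodesicForce (A : E → E →L[ℝ] E →L[ℝ] ℝ) (z : E × E) : E →L[ℝ] ℝ :=
  (2 : ℝ)⁻¹ • (fderiv ℝ (fun x : E × E => A x.1 x.2 x.2) z).comp (ContinuousLinearMap.inl ℝ E E)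
    - fderiv ℝ (fun x : E × E => A x.1 x.2) z (z.2, 0)

/-- The vector field `(y, v) ↦ (v, (A y)⁻¹ (-Γ(v, v; ·)))` on `E × E`, the first order form of the
geodesic equation of the field `A` of bilinear forms. -/
noncomputable def geodesicField (A : E → E →L[ℝ] E →L[ℝ] ℝ) (z : E × E) : E × E :=
  (z.2, (A z.1).inverse (geodesicForce A z))

variable {A : E → E →L[ℝ] E →L[ℝ] ℝ}

theorem geodesicForce_apply {y : E} (hA : DifferentiableAt ℝ A y) (v w : E) :
    geodesicForce A (y, v) w
      = 2⁻¹ * fderiv ℝ (fun x => A x v v) y w - fderiv ℝ (fun x => A x v w) y v := by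
  have hi : HasFDerivAt (fun x : E => (x, v)) (ContinuousLinearMap.inl ℝ E E) y :=
    (hasFDerivAt_id y).prodMk (hasFDerivAt_const v y)
  have hA' : DifferentiableAt ℝ (A ∘ Prod.fst : E × E → E →L[ℝ] E →L[ℝ] ℝ) (y, v) :=
    DifferentiableAt.comp (f := (Prod.fst : E × E → E)) (y, v) hA differentiableAt_fst
  have h1 : DifferentiableAt ℝ (fun x : E × E => A x.1 x.2) (y, v) :=
    hA'.clm_apply differentiableAt_snd
  have h2 : DifferentiableAt ℝ (fun x : E × E => A x.1 x.2 x.2) (y, v) :=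
    h1.clm_apply differentiableAt_snd
  have e1 : fderiv ℝ (fun x => A x v v) y
      = (fderiv ℝ (fun x : E × E => A x.1 x.2 x.2) (y, v)).comp
        (ContinuousLinearMap.inl ℝ E E) :=
    (HasFDerivAt.comp (g := fun x : E × E => A x.1 x.2 x.2) y h2.hasFDerivAt hi).fderiv
  have e2 : fderiv ℝ (fun x => A x v w) y v
      = fderiv ℝ (fun x : E × E => A x.1 x.2) (y, v) (v, 0) w := by
    have h3 := (HasFDerivAt.comp (g := fun x : E × E => A x.1 x.2) y h1.hasFDerivAt hi).clm_apply
      (hasFDerivAt_const w y)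
    have h4 := h3.fderiv
    simp only [Function.comp_def] at h4
    rw [h4]
    simp
  rw [e1, e2]
  rfl

theorem contDiffAt_geodesicField [CompleteSpace E] {U : Set E}
    (hA : ContDiffOn ℝ 2 A U) (hU : IsOpen U) {z : E × E} (hz : z.1 ∈ U)
    (hinv : (A z.1).IsInvertible) : ContDiffAt ℝ 1 (geodesicField A) z := by
  have h0 : ContDiffAt ℝ 2 (fun x : E × E => A x.1) z :=
    ContDiffAt.comp (g := A) z (hA.contDiffAt (hU.mem_nhds hz)) contDiffAt_fst
  have h1 : ContDiffAt ℝ 2 (fun x : E × E => A x.1 x.2) z := h0.clm_apply contDiffAt_snd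
  have h2 : ContDiffAt ℝ 2 (fun x : E × E => A x.1 x.2 x.2) z := h1.clm_apply contDiffAt_snd
  have h3 : ContDiffAt ℝ 1 (geodesicForce A) z :=
    (((h2.fderiv_right (m := 1) (by norm_num)).clm_comp contDiffAt_const).const_smul (2 : ℝ)⁻¹).sub
      ((h1.fderiv_right (m := 1) (by norm_num)).clm_apply (contDiffAt_snd.prodMk contDiffAt_const))
  have h4 : ContDiffAt ℝ 1 (fun x : E × E => (A x.1).inverse) z :=
    ContDiffAt.comp (g := ContinuousLinearMap.inverse) z hinv.contDiffAt_map_inverse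
      (h0.of_le (by norm_num))
  exact contDiffAt_snd.prodMk (h4.clm_apply h3)

end GeodesicField

section ChartCalculus

variable {E : Type*} [NormedAddCommGroup E] [NormedSpace ℝ E]
  {M : Type*} [MetricSpace M] [ChartedSpace E M]
  [RiemannianBundle (fun x : M => TangentSpace 𝓘(ℝ, E) x)]

/-- The derivative of the inverse of the chart at `p`, which sends coordinate vectors at `y` to
tangent vectors of `M`. -/
noncomputable def chartFrame (p : M) (y : E) :
    E →L[ℝ] TangentSpace 𝓘(ℝ, E) ((chartAt E p).symm y) :=
  mfderiv 𝓘(ℝ, E) 𝓘(ℝ, E) (chartAt E p).symm y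

theorem chartMetric_eq_inner (p : M) (y v w : E) :
    chartMetric p y v w = inner ℝ (chartFrame p y v) (chartFrame p y w) := rfl

theorem chartMetric_add_left (p : M) (y v v' w : E) :
    chartMetric p y (v + v') w = chartMetric p y v w + chartMetric p y v' w := by
  simp only [chartMetric_eq_inner, map_add]
  exact inner_add_left _ _ _

theorem chartMetric_smul_left (p : M) (y : E) (a : ℝ) (v w : E) :
    chartMetric p y (a • v) w = a * chartMetric p y v w := by
  simp only [chartMetric_eq_inner, map_smul]
  exact real_inner_smul_left _ _ _

theorem chartMetric_comm (p : M) (y v w : E) : chartMetric p y v w = chartMetric p y w v :=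
  real_inner_comm (F := TangentSpace 𝓘(ℝ, E) ((chartAt E p).symm y)) _ _

theorem chartMetric_add_right (p : M) (y v w w' : E) :
    chartMetric p y v (w + w') = chartMetric p y v w + chartMetric p y v w' := by
  simp only [chartMetric_comm p y v, chartMetric_add_left]

theorem chartMetric_smul_right (p : M) (y : E) (a : ℝ) (v w : E) :
    chartMetric p y v (a • w) = a * chartMetric p y v w := by
  simp only [chartMetric_comm p y v, chartMetric_smul_left]

theorem eq_zero_of_chartMetric_self_eq_zero [IsManifold 𝓘(ℝ, E) ∞ M] (p : M) {y v : E}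
    (hy : y ∈ (chartAt E p).target) (h : chartMetric p y v v = 0) : v = 0 := by
  have : IsManifold 𝓘(ℝ, E) 1 M := .of_le (n := ∞) (by norm_cast)
  have h1 := inner_self_eq_zero (𝕜 := ℝ)
    (E := TangentSpace 𝓘(ℝ, E) ((chartAt E p).symm y)) |>.1 h
  exact (mdifferentiable_chart (I := 𝓘(ℝ, E)) p).symm.mfderiv_injective hy
    (h1.trans (map_zero _).symm)

/-- The coordinate frame is the image of constant vector fields under the tangent map of the inverse
chart, so the smoothness of the bundle metric passes to its coefficients. -/
theorem contDiffOn_chartMetric [IsManifold 𝓘(ℝ, E) ∞ M]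
    [IsContMDiffRiemannianBundle 𝓘(ℝ, E) ∞ E (fun x : M => TangentSpace 𝓘(ℝ, E) x)]
    (p : M) (v w : E) :
    ContDiffOn ℝ ∞ (fun y => chartMetric p y v w) (chartAt E p).target := by
  have : IsManifold 𝓘(ℝ, E) 1 M := .of_le (n := ∞) (by norm_cast)
  rw [← contMDiffOn_iff_contDiffOn]
  have key : ∀ v : E, ContMDiffOn 𝓘(ℝ, E) (𝓘(ℝ, E).prod 𝓘(ℝ, E)) ∞
      (fun y => (⟨(chartAt E p).symm y, mfderiv 𝓘(ℝ, E) 𝓘(ℝ, E) (chartAt E p).symm y v⟩ :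
        TangentBundle 𝓘(ℝ, E) M)) (chartAt E p).target := by
    intro v
    have h1 := (contMDiffOn_chart_symm (I := 𝓘(ℝ, E)) (n := ∞)
      (x := p)).contMDiffOn_tangentMapWithin (m := ∞) le_rfl (chartAt E p).open_target.uniqueMDiffOn
    have h2 : ContMDiff 𝓘(ℝ, E) (𝓘(ℝ, E).prod 𝓘(ℝ, E)) ∞
        (fun y : E => (⟨y, v⟩ : TangentBundle 𝓘(ℝ, E) E)) :=
      contMDiff_vectorSpace_iff_contDiff.2 contDiff_const
    refine (h1.comp h2.contMDiffOn fun y hy => hy).congr fun y hy => ?_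
    simp only [Function.comp, tangentMapWithin]
    rw [mfderivWithin_of_isOpen (chartAt E p).open_target hy]
  exact ContMDiffOn.inner_bundle (E := fun x : M => TangentSpace 𝓘(ℝ, E) x) (key v) (key w)

variable [FiniteDimensional ℝ E]

/-- The metric in the chart at `p` as a field of continuous bilinear forms. It is defined at all
points of `E`, but is smooth and nondegenerate only on the target of the chart. -/
noncomputable def metricForm (p : M) (y : E) : E →L[ℝ] E →L[ℝ] ℝ :=
  (LinearMap.toContinuousLinearMap.toLinearMap ∘ₗ
    LinearMap.mk₂ ℝ (chartMetric p y) (chartMetric_add_left p y)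
      (chartMetric_smul_left p y) (chartMetric_add_right p y)
      (fun a v w => chartMetric_smul_right p y a v w)).toContinuousLinearMap

@[simp]
theorem metricForm_apply (p : M) (y v w : E) : metricForm p y v w = chartMetric p y v w := rfl

theorem isInvertible_metricForm [IsManifold 𝓘(ℝ, E) ∞ M] (p : M) {y : E}
    (hy : y ∈ (chartAt E p).target) : (metricForm p y).IsInvertible := by
  have hinj : Function.Injective (metricForm p y : E →ₗ[ℝ] E →L[ℝ] ℝ) := by
    refine (injective_iff_map_eq_zero _).2 fun v hv => ?_
    refine eq_zero_of_chartMetric_self_eq_zero p hy ?_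
    rw [← metricForm_apply]
    exact congrArg (fun f : E →L[ℝ] ℝ => f v) hv
  have hfin : Module.finrank ℝ E = Module.finrank ℝ (E →L[ℝ] ℝ) := by
    rw [← (LinearMap.toContinuousLinearMap (𝕜 := ℝ) (E := E) (F' := ℝ)).finrank_eq]
    exact (Subspace.dual_finrank_eq (K := ℝ) (V := E)).symm
  exact ⟨(LinearEquiv.ofInjectiveOfFinrankEq _ hinj hfin).toContinuousLinearEquiv, by ext; rfl⟩

variable [IsManifold 𝓘(ℝ, E) ∞ M]
  [IsContMDiffRiemannianBundle 𝓘(ℝ, E) ∞ E (fun x : M => TangentSpace 𝓘(ℝ, E) x)]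

theorem contDiffOn_metricForm (p : M) :
    ContDiffOn ℝ ∞ (metricForm p) (chartAt E p).target :=
  contDiffOn_clm_apply.2 fun v => contDiffOn_clm_apply.2 fun w => contDiffOn_chartMetric p v w

theorem differentiableAt_metricForm (p : M) {y : E} (hy : y ∈ (chartAt E p).target) :
    DifferentiableAt ℝ (metricForm p) y :=
  ((contDiffOn_metricForm p).contDiffAt ((chartAt E p).open_target.mem_nhds hy)).differentiableAt
    (by norm_num)

theorem fderiv_chartMetric (p : M) {y : E} (hy : y ∈ (chartAt E p).target) (v w a : E) :
    fderiv ℝ (fun z => chartMetric p z v w) y a = fderiv ℝ (metricForm p) y a v w := by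
  have h := (((differentiableAt_metricForm p hy).hasFDerivAt.clm_apply
    (hasFDerivAt_const v y)).clm_apply (hasFDerivAt_const w y)).fderiv
  have h' : (fun z => chartMetric p z v w) = fun z => metricForm p z v w := rfl
  rw [h', h]
  simp

theorem chartChristoffel_eq (p : M) {y : E} (hy : y ∈ (chartAt E p).target) (a b w : E) :
    chartChristoffel p y a b w = (fderiv ℝ (metricForm p) y a b w
      + fderiv ℝ (metricForm p) y b a w - fderiv ℝ (metricForm p) y w a b) / 2 := by
  simp only [chartChristoffel, fderiv_chartMetric p hy]

theorem geodesicForce_metricForm (p : M) {y : E} (hy : y ∈ (chartAt E p).target) (v w : E) :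
    geodesicForce (metricForm p) (y, v) w = -chartChristoffel p y v v w := by
  rw [geodesicForce_apply (differentiableAt_metricForm p hy), chartChristoffel]
  simp only [metricForm_apply]
  ring

theorem contDiffAt_geodesicField_metricForm (p : M) {z : E × E}
    (hz : z.1 ∈ (chartAt E p).target) : ContDiffAt ℝ 1 (geodesicField (metricForm p)) z :=
  contDiffAt_geodesicField ((contDiffOn_metricForm p).of_le (by norm_cast))
    (chartAt E p).open_target hz (isInvertible_metricForm p hz)

end ChartCalculus

/-! ### Geodesics: affine reparametrization, uniqueness, constant speed -/

theorem deriv_comp_affine {F : Type*} [NormedAddCommGroup F] [NormedSpace ℝ F] (f : ℝ → F)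
    (a b s : ℝ) : deriv (fun s => f (a * s + b)) s = a • deriv f (a * s + b) := by
  rw [deriv_comp_mul_left a (fun x => f (x + b)) s, deriv_comp_add_const]

section Coordinates

variable {E : Type*} [NormedAddCommGroup E] [NormedSpace ℝ E]
  {M : Type*} [MetricSpace M] [ChartedSpace E M]

variable (E) in
/-- The curve in the tangent bundle formed by the points of a curve and its velocity vectors. -/
noncomputable def velocityLift (γ : ℝ → M) (t : ℝ) : TangentBundle 𝓘(ℝ, E) M :=
  ⟨γ t, velocity E γ t⟩

theorem velocity_comp_affine {γ : ℝ → M} (hγ : ContMDiff 𝓘(ℝ, ℝ) 𝓘(ℝ, E) ∞ γ) (a b s : ℝ) :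
    velocity E (fun s => γ (a * s + b)) s = a • velocity E γ (a * s + b) := by
  have hf : HasDerivAt (fun s : ℝ => a * s + b) a s := by
    simpa using ((hasDerivAt_id s).const_mul a).add_const b
  have h1 : MDifferentiableAt 𝓘(ℝ, ℝ) 𝓘(ℝ, E) γ (a * s + b) :=
    hγ.mdifferentiable (by norm_num) _
  have h2 := h1.hasMFDerivAt.comp s hf.hasFDerivAt.hasMFDerivAt
  have h3 : mfderiv 𝓘(ℝ, ℝ) 𝓘(ℝ, E) (fun s => γ (a * s + b)) s = _ := h2.mfderiv
  rw [velocity, h3]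
  change mfderiv 𝓘(ℝ, ℝ) 𝓘(ℝ, E) γ (a * s + b) ((1 : ℝ) • a) = _
  rw [show (1 : ℝ) • a = a • (1 : ℝ) by simp]
  exact map_smul (mfderiv 𝓘(ℝ, ℝ) 𝓘(ℝ, E) γ (a * s + b)) a (1 : ℝ)

theorem velocityLift_comp_affine {γ : ℝ → M} (hγ : ContMDiff 𝓘(ℝ, ℝ) 𝓘(ℝ, E) ∞ γ) (a b s : ℝ) :
    velocityLift E (fun s => γ (a * s + b)) s
      = ⟨γ (a * s + b), a • velocity E γ (a * s + b)⟩ := by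
  rw [velocityLift, velocity_comp_affine hγ]

theorem eventually_mem_source {E M : Type*} [TopologicalSpace E] [TopologicalSpace M]
    [ChartedSpace E M] {γ : ℝ → M} (hγ : Continuous γ) {p : M} {t : ℝ}
    (ht : γ t ∈ (chartAt E p).source) : ∀ᶠ s in 𝓝 t, γ s ∈ (chartAt E p).source :=
  hγ.continuousAt.eventually ((chartAt E p).open_source.mem_nhds ht)

theorem norm_velocity_congr [RiemannianBundle (fun x : M => TangentSpace 𝓘(ℝ, E) x)]
    {γ σ : ℝ → M} {t : ℝ} (h : γ =ᶠ[𝓝 t] σ) : ‖velocity E γ t‖ = ‖velocity E σ t‖ := by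
  -- the two velocities are the same element of `E`, but the norm depends on the base point
  have key : ∀ {x y : M} (hxy : x = y) (v : TangentSpace 𝓘(ℝ, E) x) (w : TangentSpace 𝓘(ℝ, E) y),
      (show E from v) = (show E from w) → ‖v‖ = ‖w‖ := by
    rintro x y rfl v w hvw
    exact congrArg _ hvw
  exact key h.eq_of_nhds _ _ (congrArg (fun L : ℝ →L[ℝ] E => L 1) h.mfderiv_eq)

variable [IsManifold 𝓘(ℝ, E) ∞ M]

theorem contDiffAt_coord {γ : ℝ → M} (hγ : ContMDiff 𝓘(ℝ, ℝ) 𝓘(ℝ, E) ∞ γ) {p : M} {t : ℝ}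
    (ht : γ t ∈ (chartAt E p).source) : ContDiffAt ℝ ∞ (fun s => chartAt E p (γ s)) t :=
  contMDiffAt_iff_contDiffAt.1 <|
    ((contMDiffOn_chart (I := 𝓘(ℝ, E)) (n := ∞) (x := p)).contMDiffAt
      ((chartAt E p).open_source.mem_nhds ht)).comp t hγ.contMDiffAt

theorem hasDerivAt_coord {γ : ℝ → M} (hγ : ContMDiff 𝓘(ℝ, ℝ) 𝓘(ℝ, E) ∞ γ) {p : M} {t : ℝ}
    (ht : γ t ∈ (chartAt E p).source) :
    HasDerivAt (fun s => chartAt E p (γ s)) (deriv (fun s => chartAt E p (γ s)) t) t :=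
  ((contDiffAt_coord hγ ht).differentiableAt (by norm_num)).hasDerivAt

theorem hasDerivAt_deriv_coord {γ : ℝ → M} (hγ : ContMDiff 𝓘(ℝ, ℝ) 𝓘(ℝ, E) ∞ γ) {p : M} {t : ℝ}
    (ht : γ t ∈ (chartAt E p).source) :
    HasDerivAt (deriv fun s => chartAt E p (γ s))
      (deriv (deriv fun s => chartAt E p (γ s)) t) t := by
  have h := (contDiffAt_coord hγ ht).fderiv_right (m := 1) (by norm_cast)
  exact ((h.clm_apply (contDiffAt_const (c := (1 : ℝ)))).differentiableAt (by norm_num)).hasDerivAt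

/-- The coordinate velocity depends only on the velocity in the tangent bundle. -/
theorem deriv_coord {γ : ℝ → M} (hγ : ContMDiff 𝓘(ℝ, ℝ) 𝓘(ℝ, E) ∞ γ) {p : M} {t : ℝ}
    (ht : γ t ∈ (chartAt E p).source) :
    deriv (fun s => chartAt E p (γ s)) t
      = mfderiv 𝓘(ℝ, E) 𝓘(ℝ, E) (chartAt E p) (velocityLift E γ t).1 (velocityLift E γ t).2 := by
  have : IsManifold 𝓘(ℝ, E) 1 M := .of_le (n := ∞) (by norm_cast)
  have h1 : MDifferentiableAt 𝓘(ℝ, ℝ) 𝓘(ℝ, E) γ t := hγ.mdifferentiable (by norm_num) _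
  have h2 := (mdifferentiable_chart (I := 𝓘(ℝ, E)) p).mdifferentiableAt ht
  have h3 := (h2.hasMFDerivAt.comp t h1.hasMFDerivAt).mfderiv
  rw [mfderiv_eq_fderiv] at h3
  rw [← fderiv_apply_one_eq_deriv]
  exact congrArg (fun L : ℝ →L[ℝ] E => L 1) h3

/-- The velocity vector in `M` is the image of the coordinate velocity under the chart frame. The
curve is passed through the chart and back so that both sides lie in the same tangent space. -/
theorem velocity_symm_coord {γ : ℝ → M} (hγ : ContMDiff 𝓘(ℝ, ℝ) 𝓘(ℝ, E) ∞ γ) {p : M} {t : ℝ}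
    (ht : γ t ∈ (chartAt E p).source) :
    velocity E (fun s => (chartAt E p).symm (chartAt E p (γ s))) t
      = chartFrame p (chartAt E p (γ t)) (deriv (fun s => chartAt E p (γ s)) t) := by
  have : IsManifold 𝓘(ℝ, E) 1 M := .of_le (n := ∞) (by norm_cast)
  have h1 := (hasDerivAt_coord hγ ht).hasFDerivAt
  have h2 := (mdifferentiable_chart (I := 𝓘(ℝ, E)) p).mdifferentiableAt_symm
    ((chartAt E p).map_source ht)
  have h3 := (h2.hasMFDerivAt.comp t h1.hasMFDerivAt).mfderiv
  have h4 := congrArg (fun L : ℝ →L[ℝ] E => L 1) h3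
  refine Eq.trans h4 ?_
  change mfderiv 𝓘(ℝ, E) 𝓘(ℝ, E) (chartAt E p).symm (chartAt E p (γ t))
    ((1 : ℝ) • deriv (fun s => chartAt E p (γ s)) t) = _
  rw [one_smul]
  rfl

variable [RiemannianBundle (fun x : M => TangentSpace 𝓘(ℝ, E) x)]

theorem norm_velocity_sq {γ : ℝ → M} (hγ : ContMDiff 𝓘(ℝ, ℝ) 𝓘(ℝ, E) ∞ γ) {p : M} {t : ℝ}
    (ht : γ t ∈ (chartAt E p).source) :
    ‖velocity E γ t‖ ^ 2 = chartMetric p (chartAt E p (γ t))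
      (deriv (fun s => chartAt E p (γ s)) t) (deriv (fun s => chartAt E p (γ s)) t) := by
  have h1 : γ =ᶠ[𝓝 t] fun s => (chartAt E p).symm (chartAt E p (γ s)) := by
    filter_upwards [eventually_mem_source hγ.continuous ht] with s hs
    exact ((chartAt E p).left_inv hs).symm
  rw [norm_velocity_congr h1, velocity_symm_coord hγ ht, chartMetric_eq_inner,
    real_inner_self_eq_norm_sq]

end Coordinates

section Geodesic

variable {E : Type*} [NormedAddCommGroup E] [NormedSpace ℝ E]
  {M : Type*} [MetricSpace M] [ChartedSpace E M]
  [RiemannianBundle (fun x : M => TangentSpace 𝓘(ℝ, E) x)]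

theorem IsGeodesic.continuous {γ : ℝ → M} (hγ : IsGeodesic E γ) : Continuous γ := hγ.1.continuous

variable [IsManifold 𝓘(ℝ, E) ∞ M] [FiniteDimensional ℝ E]
  [IsContMDiffRiemannianBundle 𝓘(ℝ, E) ∞ E (fun x : M => TangentSpace 𝓘(ℝ, E) x)]

theorem IsGeodesic.comp_affine {γ : ℝ → M} (hγ : IsGeodesic E γ) (a b : ℝ) :
    IsGeodesic E (fun s => γ (a * s + b)) := by
  refine ⟨hγ.1.comp (contMDiff_iff_contDiff.2 (by fun_prop)), fun p t ht => ?_⟩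
  intro u w
  set v : ℝ → E := fun s => chartAt E p (γ s) with hv
  have h1 : deriv u = fun s => a • deriv v (a * s + b) := funext (deriv_comp_affine v a b)
  have h2 : deriv (deriv u) t = a • a • deriv (deriv v) (a * t + b) := by
    rw [h1, deriv_fun_const_smul_field, deriv_comp_affine]
  have hy := (chartAt E p).map_source ht
  have h3 := hγ.2 p (a * t + b) ht w
  simp only at h3
  have hu : u t = v (a * t + b) := rfl
  have hy' : v (a * t + b) ∈ (chartAt E p).target := hy
  rw [h2, h1, hu]
  simp only [chartChristoffel_eq p hy'] at h3 ⊢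
  rw [chartChristoffel_eq p hy'] at h3
  simp only [chartMetric_smul_left, map_smul, _root_.smul_apply, smul_eq_mul]
  linear_combination a ^ 2 * h3

/-- In a chart, a geodesic and its coordinate velocity solve the first order geodesic equation. -/
theorem IsGeodesic.hasDerivAt_coord_prodMk {γ : ℝ → M} (hγ : IsGeodesic E γ) {p : M} {t : ℝ}
    (ht : γ t ∈ (chartAt E p).source) :
    HasDerivAt (fun s => (chartAt E p (γ s), deriv (fun s => chartAt E p (γ s)) s))
      (geodesicField (metricForm p)
        (chartAt E p (γ t), deriv (fun s => chartAt E p (γ s)) t)) t := by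
  have hy := (chartAt E p).map_source ht
  convert (hasDerivAt_coord hγ.1 ht).prodMk (hasDerivAt_deriv_coord hγ.1 ht) using 1
  refine Prod.ext rfl ?_
  change (metricForm p _).inverse _ = _
  rw [ContinuousLinearMap.IsInvertible.inverse_apply_eq (isInvertible_metricForm p hy)]
  ext w
  rw [geodesicForce_metricForm p hy, metricForm_apply]
  linarith [hγ.2 p t ht w]

/-- Local uniqueness of geodesics, from the local Lipschitz continuity of the geodesic field. -/
theorem IsGeodesic.eventuallyEq {γ σ : ℝ → M} (hγ : IsGeodesic E γ) (hσ : IsGeodesic E σ)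
    {p : M} {t : ℝ} (ht : γ t ∈ (chartAt E p).source) (h : γ t = σ t)
    (h' : deriv (fun s => chartAt E p (γ s)) t = deriv (fun s => chartAt E p (σ s)) t) :
    γ =ᶠ[𝓝 t] σ := by
  have ht' : σ t ∈ (chartAt E p).source := h ▸ ht
  obtain ⟨K, S, hS, hK⟩ := (contDiffAt_geodesicField_metricForm p
    (z := (chartAt E p (γ t), deriv (fun s => chartAt E p (γ s)) t))
    ((chartAt E p).map_source ht)).exists_lipschitzOnWith
  have hS' : S ∈ 𝓝 (chartAt E p (σ t), deriv (fun s => chartAt E p (σ s)) t) := by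
    rwa [← h', ← h]
  have h1 := ODE_solution_unique_of_eventually (t₀ := t) (s := fun _ => S)
    (v := fun _ => geodesicField (metricForm p)) (.of_forall fun _ => hK)
    (f := fun s => (chartAt E p (γ s), deriv (fun s => chartAt E p (γ s)) s))
    (g := fun s => (chartAt E p (σ s), deriv (fun s => chartAt E p (σ s)) s))
    (((eventually_mem_source hγ.continuous ht).mono fun s hs => hγ.hasDerivAt_coord_prodMk hs).and
      ((hγ.hasDerivAt_coord_prodMk ht).continuousAt.eventually hS))
    (((eventually_mem_source hσ.continuous ht').mono fun s hs => hσ.hasDerivAt_coord_prodMk hs).and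
      ((hσ.hasDerivAt_coord_prodMk ht').continuousAt.eventually hS'))
    (by simp only [h', h])
  filter_upwards [h1, eventually_mem_source hγ.continuous ht,
    eventually_mem_source hσ.continuous ht'] with s hs hs1 hs2
  exact (chartAt E p).injOn hs1 hs2 (congrArg Prod.fst hs)

/-- Two geodesics with the same velocity vector at one time are equal: the set of times near which
they agree is open, and closed by local uniqueness at a limit time. -/
theorem IsGeodesic.eq_of_deriv_coord_eq {γ σ : ℝ → M} (hγ : IsGeodesic E γ)
    (hσ : IsGeodesic E σ) {p : M} {t : ℝ} (ht : γ t ∈ (chartAt E p).source) (h : γ t = σ t)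
    (h' : deriv (fun s => chartAt E p (γ s)) t = deriv (fun s => chartAt E p (σ s)) t) :
    γ = σ := by
  have hopen : IsOpen {s | γ =ᶠ[𝓝 s] σ} := isOpen_setOfPred_eventually_nhds
  have hclosed : IsClosed {s | γ =ᶠ[𝓝 s] σ} := by
    refine isClosed_of_closure_subset fun s hs => ?_
    have hs' : ∃ᶠ x in 𝓝 s, γ =ᶠ[𝓝 x] σ := mem_closure_iff_frequently.1 hs
    have e : γ s = σ s :=
      (isClosed_eq hγ.continuous hσ.continuous).mem_of_frequently_of_tendsto
        (hs'.mono fun x hx => hx.eq_of_nhds) tendsto_id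
    have hm : γ s ∈ (chartAt E (γ s)).source := mem_chart_source E (γ s)
    refine hγ.eventuallyEq hσ hm e ?_
    have hm' : σ s ∈ (chartAt E (γ s)).source := by rwa [← e]
    have c1 := (hasDerivAt_deriv_coord hγ.1 hm).continuousAt
    have c2 := (hasDerivAt_deriv_coord hσ.1 hm').continuousAt
    refine tendsto_nhds_unique_of_frequently_eq c1 c2 (hs'.mono fun x hx => ?_)
    exact (hx.fun_comp (chartAt E (γ s))).deriv_eq
  have huniv : {s | γ =ᶠ[𝓝 s] σ} = univ :=
    IsClopen.eq_univ ⟨hclosed, hopen⟩ ⟨t, hγ.eventuallyEq hσ ht h h'⟩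
  funext s
  exact (huniv.symm ▸ mem_univ s : s ∈ {s | γ =ᶠ[𝓝 s] σ}).eq_of_nhds

theorem IsGeodesic.eq_of_velocityLift_eq {γ σ : ℝ → M} (hγ : IsGeodesic E γ)
    (hσ : IsGeodesic E σ) {t : ℝ} (h : velocityLift E γ t = velocityLift E σ t) : γ = σ := by
  have h0 : γ t = σ t := congrArg TotalSpace.proj h
  have hm : γ t ∈ (chartAt E (γ t)).source := mem_chart_source E (γ t)
  refine hγ.eq_of_deriv_coord_eq hσ hm h0 ?_
  rw [deriv_coord hγ.1 hm, deriv_coord hσ.1 (h0 ▸ hm), h]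

/-- Geodesics have constant speed: the geodesic equation, tested against the velocity, says that the
derivative of the squared speed is zero, because `2 Γ(v, v; v) = ∂_v g(v, v)`. -/
theorem IsGeodesic.norm_velocity_eq {γ : ℝ → M} (hγ : IsGeodesic E γ) (s t : ℝ) :
    ‖velocity E γ s‖ = ‖velocity E γ t‖ := by
  have key : ∀ t, HasDerivAt (fun s => ‖velocity E γ s‖ ^ 2) 0 t := by
    intro t
    set p := γ t
    have hm : γ t ∈ (chartAt E p).source := mem_chart_source E (γ t)
    have hy := (chartAt E p).map_source hm
    set u : ℝ → E := fun s => chartAt E p (γ s) with hu_def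
    have h2 : HasDerivAt (deriv u) (deriv (deriv u) t) t := hasDerivAt_deriv_coord hγ.1 hm
    have h3 : HasDerivAt (metricForm p ∘ u) (fderiv ℝ (metricForm p) (u t) (deriv u t)) t :=
      (differentiableAt_metricForm p hy).hasFDerivAt.comp_hasDerivAt t (hasDerivAt_coord hγ.1 hm)
    have h4 := (h3.clm_apply h2).clm_apply h2
    have h5 : chartMetric p (u t) (deriv (deriv u) t) (deriv u t)
        + chartChristoffel p (u t) (deriv u t) (deriv u t) (deriv u t) = 0 :=
      hγ.2 p t hm (deriv u t)
    rw [chartChristoffel_eq p hy] at h5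
    refine (h4.congr_deriv ?_).congr_of_eventuallyEq ?_
    · simp only [_root_.add_apply, metricForm_apply, Function.comp_apply]
      rw [chartMetric_comm p (u t) (deriv u t)]
      linarith
    · filter_upwards [eventually_mem_source hγ.continuous hm] with s hs
      exact norm_velocity_sq hγ.1 hs
  have h := is_const_of_deriv_eq_zero (fun t => (key t).differentiableAt)
    (fun t => (key t).deriv) s t
  exact (sq_eq_sq₀ (norm_nonneg _) (norm_nonneg _)).1 h

end Geodesic

/-! ### Intersections of two geodesics -/

section Crossings

variable {E : Type*} [NormedAddCommGroup E] [NormedSpace ℝ E]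
  {M : Type*} [MetricSpace M] [ChartedSpace E M] [IsManifold 𝓘(ℝ, E) ∞ M]
  [RiemannianBundle (fun x : M => TangentSpace 𝓘(ℝ, E) x)]
  {γ σ : ℝ → M}

/-- A geodesic of positive speed does not turn back. -/
theorem IsGeodesic.not_reflection (hγ : IsGeodesic E γ) {v : ℝ} (hv : 0 < v)
    (hγv : ∀ t, ‖velocity E γ t‖ = v) (t s : ℝ) : ¬ ∀ x, γ (t + x) = γ (s - x) := by
  intro h
  have e : γ = fun x => γ (-1 * x + (t + s)) := by
    funext x
    have := h (x - t)
    rw [show t + (x - t) = x by ring] at this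
    rw [this]
    congr 1
    ring
  -- the velocity at the midpoint of the reflection is equal to its opposite
  have hm : γ ((t + s) / 2) ∈ (chartAt E (γ ((t + s) / 2))).source := mem_chart_source E _
  set u : ℝ → E := fun r => chartAt E (γ ((t + s) / 2)) (γ r) with hu
  have e1 : u = fun x => u (-1 * x + (t + s)) := by
    funext x
    exact congrArg (chartAt E (γ ((t + s) / 2))) (congrFun e x)
  have e2 : deriv u ((t + s) / 2) = -deriv u ((t + s) / 2) := by
    conv_lhs => rw [e1, deriv_comp_affine u]
    rw [neg_one_smul]
    congr 2
    ring
  have e3 : deriv u ((t + s) / 2) = 0 := by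
    have e5 : (2 : ℝ) • deriv u ((t + s) / 2) = 0 := by
      rw [two_smul, ← sub_neg_eq_add, ← e2, sub_self]
    exact (smul_eq_zero.1 e5).resolve_left two_ne_zero
  have e4 := norm_velocity_sq hγ.1 hm
  change _ = chartMetric _ _ (deriv u _) (deriv u _) at e4
  rw [hγv, e3, ← zero_smul ℝ (0 : E), chartMetric_smul_left, zero_mul] at e4
  exact (pow_pos hv 2).ne' e4

variable [FiniteDimensional ℝ E]
  [IsContMDiffRiemannianBundle 𝓘(ℝ, E) ∞ E (fun x : M => TangentSpace 𝓘(ℝ, E) x)]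

/-- If the velocity of `γ` is `a` times that of `σ` at a common point, then `γ` follows `σ` with the
time multiplied by `a`; the cases `a = 1` and `a = -1` are translations and reflections of time. -/
theorem IsGeodesic.eq_of_deriv_coord_eq_smul (hγ : IsGeodesic E γ) (hσ : IsGeodesic E σ) {p : M}
    {t s : ℝ} (ht : γ t ∈ (chartAt E p).source) (h : γ t = σ s) {a : ℝ}
    (h' : deriv (fun r => chartAt E p (γ r)) t = a • deriv (fun r => chartAt E p (σ r)) s) (x : ℝ) :
    γ (t + x) = σ (s + a * x) := by
  have e := (hγ.comp_affine 1 t).eq_of_deriv_coord_eq (hσ.comp_affine a s) (p := p) (t := 0)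
    (by simpa using ht) (by simpa using h) (by
      rw [deriv_comp_affine (fun r => chartAt E p (γ r)),
        deriv_comp_affine (fun r => chartAt E p (σ r))]
      simpa using h')
  have := congrFun e x
  rwa [one_mul, add_comm, add_comm (a * x)] at this

/-- Two geodesics of the same speed which meet at a nonzero angle have no further intersections at
nearby times. -/
theorem IsGeodesic.eventually_ne_of_transverse (hγ : IsGeodesic E γ) (hσ : IsGeodesic E σ)
    {v : ℝ} (hv : 0 < v) {t s : ℝ} (hγv : ‖velocity E γ t‖ = v) (hσv : ‖velocity E σ s‖ = v)
    (h : γ t = σ s) (h1 : ¬ ∀ x, γ (t + x) = σ (s + x)) (h2 : ¬ ∀ x, γ (t + x) = σ (s - x)) :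
    ∀ᶠ z : ℝ × ℝ in 𝓝[≠] (t, s), γ z.1 ≠ σ z.2 := by
  set p := γ t with hp
  have hm : γ t ∈ (chartAt E p).source := mem_chart_source E (γ t)
  have hm' : σ s ∈ (chartAt E p).source := h ▸ hm
  set x := deriv (fun r => chartAt E p (γ r)) t with hx
  set y := deriv (fun r => chartAt E p (σ r)) s with hy
  have hxy : x ≠ y := fun e => h1 fun r => by
    simpa using hγ.eq_of_deriv_coord_eq_smul hσ (a := 1) hm h (by rw [one_smul]; exact e) r
  have hxy' : x ≠ -y := fun e => h2 fun r => by
    simpa [sub_eq_add_neg] using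
      hγ.eq_of_deriv_coord_eq_smul hσ (a := -1) hm h (by rw [neg_one_smul]; exact e) r
  have hxx : chartMetric p (chartAt E p (γ t)) x x = v ^ 2 := by
    rw [← hγv, norm_velocity_sq hγ.1 hm]
  have hyy : chartMetric p (chartAt E p (γ t)) y y = v ^ 2 := by
    rw [← hσv, norm_velocity_sq hσ.1 hm', ← h]
  -- the coordinate difference of the two curves has injective derivative `L` at `(t, s)`, since `x`
  -- and `y` have the same positive length and `x ≠ ± y`
  have hF := ((hasDerivAt_coord hγ.1 hm).hasFDerivAt.comp (f := (Prod.fst : ℝ × ℝ → ℝ)) (t, s)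
    hasFDerivAt_fst).sub ((hasDerivAt_coord hσ.1 hm').hasFDerivAt.comp
      (f := (Prod.snd : ℝ × ℝ → ℝ)) (t, s) hasFDerivAt_snd)
  set L : ℝ × ℝ →L[ℝ] E := (ContinuousLinearMap.toSpanSingleton ℝ x).comp
    (ContinuousLinearMap.fst ℝ ℝ ℝ) - (ContinuousLinearMap.toSpanSingleton ℝ y).comp
    (ContinuousLinearMap.snd ℝ ℝ ℝ)
  have hL : (L : ℝ × ℝ →ₗ[ℝ] E).ker = ⊥ := by
    refine LinearMap.ker_eq_bot'.2 fun z hz => ?_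
    replace hz : z.1 • x - z.2 • y = 0 := hz
    rw [sub_eq_zero] at hz
    have e := congrArg (fun w => chartMetric p (chartAt E p (γ t)) w w) hz
    simp only [chartMetric_smul_left, chartMetric_smul_right, hxx, hyy] at e
    have e' : (z.1 - z.2) * (z.1 + z.2) = 0 := by
      have hv2 : v ^ 2 ≠ 0 := by positivity
      refine (mul_eq_zero.1 (?_ : v ^ 2 * ((z.1 - z.2) * (z.1 + z.2)) = 0)).resolve_left hv2
      linear_combination e
    rcases mul_eq_zero.1 e' with e' | e'
    · have e2 : z.1 = z.2 := by linarith
      rw [e2, ← sub_eq_zero, ← smul_sub, smul_eq_zero, sub_eq_zero] at hz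
      have := hz.resolve_right hxy
      exact Prod.ext (e2.trans this) this
    · have e2 : z.1 = -z.2 := by linarith
      rw [e2, neg_smul, ← smul_neg, ← sub_eq_zero, ← neg_eq_zero] at hz
      have hz' : z.2 • (x - -y) = 0 := by rw [← hz]; module
      have := (smul_eq_zero.1 hz').resolve_right (sub_ne_zero.2 hxy')
      exact Prod.ext (by simp [e2, this]) this
  obtain ⟨K, -, hK⟩ := LinearMap.exists_antilipschitzWith (L : ℝ × ℝ →ₗ[ℝ] E) hL
  have hne := hF.eventually_ne (c := 0) ⟨K, hK⟩
  filter_upwards [hne] with z hz e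
  exact hz (by simp [e])

/-- Up to countably many times, an intersection of two geodesics of the same speed is a tangency,
so that the geodesics agree up to a translation or a reflection of time. -/
theorem IsGeodesic.countable_transverse (hγ : IsGeodesic E γ) (hσ : IsGeodesic E σ)
    {v : ℝ} (hv : 0 < v) (hγv : ∀ t, ‖velocity E γ t‖ = v) (hσv : ∀ t, ‖velocity E σ t‖ = v) :
    {t | ∃ s, γ t = σ s ∧ (¬ ∀ x, γ (t + x) = σ (s + x)) ∧
      ¬ ∀ x, γ (t + x) = σ (s - x)}.Countable := by
  set B : Set (ℝ × ℝ) := {z | γ z.1 = σ z.2 ∧ (¬ ∀ x, γ (z.1 + x) = σ (z.2 + x)) ∧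
      ¬ ∀ x, γ (z.1 + x) = σ (z.2 - x)} with hB
  have hdisc : DiscreteTopology B := by
    refine discreteTopology_subtype_iff.2 fun z hz => ?_
    rw [← disjoint_iff, disjoint_principal_right]
    filter_upwards [hγ.eventually_ne_of_transverse hσ hv (hγv z.1) (hσv z.2) hz.1 hz.2.1 hz.2.2]
      with w hw hwB
    exact hw hwB.1
  have hcount : B.Countable := countable_of_Lindelof_of_discrete (X := B)
  refine (hcount.image Prod.fst).mono ?_
  rintro t ⟨s, h⟩
  exact ⟨(t, s), h, rfl⟩

end Crossings

/-! ### Evenly spaced tuples, closed geodesics and minimizing directions -/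

section Tuples

variable {M : Type*} {k : ℕ} [NeZero k] {γ σ : ℝ → M}

theorem evenTuple_zero (t : ℝ) : evenTuple k γ t 0 = γ t := by
  simp [evenTuple]

theorem evenTuple_succ (hγ : Function.Periodic γ (2 * Real.pi)) (t : ℝ) (i : Fin k) :
    evenTuple k γ t (i + 1) = γ (t + 2 * Real.pi * (i : ℕ) / k + 2 * Real.pi / k) := by
  have hk : (k : ℝ) ≠ 0 := NeZero.ne _
  have h1 : ((i + 1 : Fin k) : ℕ) + k * (((i : ℕ) + 1) / k) = (i : ℕ) + 1 := by
    have : ((i + 1 : Fin k) : ℕ) = ((i : ℕ) + 1) % k := by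
      rw [Fin.val_add, Fin.val_one', Nat.add_mod_mod]
    rw [this, Nat.mod_add_div]
  have h2 : (((i + 1 : Fin k) : ℕ) : ℝ) + k * ((((i : ℕ) + 1) / k : ℕ) : ℝ) = (i : ℕ) + 1 := by
    exact_mod_cast h1
  rw [evenTuple, ← hγ.nat_mul (((i : ℕ) + 1) / k)]
  congr 1
  have h3 : ((i : ℕ) : ℝ) = ((i + 1 : Fin k) : ℕ) + k * ((((i : ℕ) + 1) / k : ℕ) : ℝ) - 1 := by
    linarith
  rw [h3]
  field_simp
  ring

theorem evenTuple_pred (hγ : Function.Periodic γ (2 * Real.pi)) (t : ℝ) (i : Fin k) :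
    evenTuple k γ t (i - 1) = γ (t + 2 * Real.pi * (i : ℕ) / k - 2 * Real.pi / k) := by
  have h := evenTuple_succ hγ (t - 2 * Real.pi / k) (i - 1)
  rw [sub_add_cancel] at h
  rw [show t + 2 * Real.pi * (i : ℕ) / k - 2 * Real.pi / k
    = t - 2 * Real.pi / k + 2 * Real.pi * (i : ℕ) / k by ring]
  refine Eq.trans ?_ h.symm
  rw [evenTuple]
  congr 1
  ring

theorem evenTuple_one (hγ : Function.Periodic γ (2 * Real.pi)) (t : ℝ) :
    evenTuple k γ t (0 + 1) = γ (t + 2 * Real.pi / k) := by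
  rw [evenTuple_succ hγ]
  simp

theorem eq_and_eq_of_evenTuple_eq (hγ : Function.Periodic γ (2 * Real.pi))
    (hσ : Function.Periodic σ (2 * Real.pi)) {t s : ℝ}
    (h : evenTuple k γ t = evenTuple k σ s) :
    γ t = σ s ∧ γ (t + 2 * Real.pi / k) = σ (s + 2 * Real.pi / k) := by
  rw [← evenTuple_zero (k := k) (γ := γ), ← evenTuple_zero (k := k) (γ := σ),
    ← evenTuple_one hγ, ← evenTuple_one hσ, h]
  exact ⟨rfl, rfl⟩

theorem uniformEnergy_evenTuple [MetricSpace M] (hγ : Function.Periodic γ (2 * Real.pi)) {d : ℝ}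
    (hd : ∀ t, dist (γ t) (γ (t + 2 * Real.pi / k)) = d) (t : ℝ) :
    uniformEnergy (evenTuple k γ t) = k ^ 2 * d ^ 2 := by
  have h : ∀ i : Fin k, dist (evenTuple k γ t i) (evenTuple k γ t (i + 1)) = d := fun i => by
    rw [evenTuple_succ hγ]
    exact hd _
  simp only [uniformEnergy, h]
  simp
  ring

end Tuples

section ClosedGeodesics

variable {E : Type*} [NormedAddCommGroup E] [NormedSpace ℝ E]
  {M : Type*} [MetricSpace M] [ChartedSpace E M]
  [RiemannianBundle (fun x : M => TangentSpace 𝓘(ℝ, E) x)] {γ σ : ℝ → M} {v : ℝ}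

theorem pathELength_of_norm_velocity_eq (hv : ∀ t, ‖velocity E γ t‖ = v) (a b : ℝ) :
    pathELength 𝓘(ℝ, E) γ a b = ENNReal.ofReal v * ENNReal.ofReal (b - a) := by
  have h : ∀ t, ‖mfderiv 𝓘(ℝ, ℝ) 𝓘(ℝ, E) γ t (1 : ℝ)‖ₑ = ENNReal.ofReal v := fun t => by
    rw [← hv t, ofReal_norm]
    rfl
  rw [pathELength_eq_lintegral_mfderiv_Icc]
  refine (MeasureTheory.lintegral_congr h).trans ?_
  rw [MeasureTheory.setLIntegral_const, Real.volume_Icc]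

theorem closedLength_of_norm_velocity_eq (hv : ∀ t, ‖velocity E γ t‖ = v) :
    closedLength E γ = 2 * Real.pi * v := by
  have h0 : 0 ≤ v := hv 0 ▸ norm_nonneg _
  rw [closedLength, pathELength_of_norm_velocity_eq hv, ENNReal.toReal_mul,
    ENNReal.toReal_ofReal h0, ENNReal.toReal_ofReal (by linarith [Real.pi_pos])]
  ring

theorem norm_velocity_comp_affine (hγ : ContMDiff 𝓘(ℝ, ℝ) 𝓘(ℝ, E) ∞ γ)
    (hv : ∀ t, ‖velocity E γ t‖ = v) (a b s : ℝ) :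
    ‖velocity E (fun s => γ (a * s + b)) s‖ = |a| * v := by
  rw [velocity_comp_affine hγ, norm_smul, hv, Real.norm_eq_abs]

/-- A curve of speed zero is constant, since its length bounds the distance of its points. -/
theorem eq_of_norm_velocity_eq_zero [IsRiemannianManifold 𝓘(ℝ, E) M]
    (hγ : ContMDiff 𝓘(ℝ, ℝ) 𝓘(ℝ, E) ∞ γ) (hv : ∀ t, ‖velocity E γ t‖ = 0) (s t : ℝ) :
    γ s = γ t := by
  wlog hst : s ≤ t
  · exact (this hγ hv t s (le_of_not_ge hst)).symm
  have h := riemannianEDist_le_pathELength (I := 𝓘(ℝ, E))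
    ((hγ.of_le (m := 1) (by norm_cast)).contMDiffOn (s := Icc s t)) rfl rfl hst
  rw [pathELength_of_norm_velocity_eq hv, ← IsRiemannianManifold.out] at h
  simpa using h

theorem norm_velocity_eq_zero_of_eventually_const {x : M} {t : ℝ} (h : γ =ᶠ[𝓝 t] fun _ => x) :
    ‖velocity E γ t‖ = 0 := by
  rw [norm_velocity_congr h, velocity, mfderiv_const]
  exact norm_zero

/-- The periods of a curve of positive speed form a totally disconnected set: a continuous
family of periods is constant. -/
theorem eq_of_continuous_of_periodic (hv0 : 0 < v)
    (hv : ∀ t, ‖velocity E γ t‖ = v) {e : ℝ → ℝ} (he : Continuous e)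
    (hp : ∀ t, Function.Periodic γ (e t)) (a b : ℝ) : e a = e b := by
  by_contra hne
  wlog hab : e a < e b generalizing a b
  · exact this b a (Ne.symm hne) ((not_lt.1 hab).lt_of_ne (Ne.symm hne))
  have hconst : ∀ x ∈ Ioo 0 (e b - e a), γ x = γ 0 := by
    intro x hx
    obtain ⟨t, ht⟩ := mem_range_of_exists_le_of_exists_ge (c := x + e a) he
      ⟨a, by linarith [hx.1]⟩ ⟨b, by linarith [hx.2]⟩
    have h1 := hp t 0
    rw [ht, zero_add, hp a x] at h1
    exact h1
  have hm : Ioo 0 (e b - e a) ∈ 𝓝 ((e b - e a) / 2) :=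
    Ioo_mem_nhds (by linarith) (by linarith)
  have := norm_velocity_eq_zero_of_eventually_const (E := E) (γ := γ) (x := γ 0)
    (Filter.eventually_of_mem hm hconst)
  rw [hv] at this
  exact hv0.ne' this

variable [IsManifold 𝓘(ℝ, E) ∞ M] [FiniteDimensional ℝ E]
  [IsContMDiffRiemannianBundle 𝓘(ℝ, E) ∞ E (fun x : M => TangentSpace 𝓘(ℝ, E) x)]

theorem IsClosedGeodesic.exists_speed [IsRiemannianManifold 𝓘(ℝ, E) M]
    (hγ : IsClosedGeodesic E γ) : ∃ v > 0, ∀ t, ‖velocity E γ t‖ = v := by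
  refine ⟨‖velocity E γ 0‖, (norm_nonneg _).lt_of_ne' fun h0 => ?_,
    fun t => hγ.1.norm_velocity_eq t 0⟩
  obtain ⟨s, t, hst⟩ := hγ.2.2
  exact hst (eq_of_norm_velocity_eq_zero hγ.1.1 (fun t => (hγ.1.norm_velocity_eq t 0).trans h0) s t)

/-- By uniqueness of geodesics, a unit vector tangent to a geodesic points along a minimizing
geodesic to `p` exactly when the given geodesic itself reaches `p` at distance `dist (γ t) p`. The
factor `a` normalizes the velocity, and its sign selects one of the two directions. -/
theorem smul_velocity_mem_minimizingDirections_iff (hγ : IsGeodesic E γ)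
    (hv : ∀ t, ‖velocity E γ t‖ = v) {a : ℝ} (ha : |a| * v = 1) (t : ℝ) (p : M) :
    a • velocity E γ t ∈ minimizingDirections E (γ t) p ↔ γ (t + a * dist (γ t) p) = p := by
  have h0 : velocityLift E (fun s => γ (a * s + t)) 0 = ⟨γ t, a • velocity E γ t⟩ := by
    rw [velocityLift_comp_affine hγ.1]
    exact congrArg (fun x => (⟨γ x, a • velocity E γ x⟩ : TangentBundle 𝓘(ℝ, E) M)) (by ring)
  rw [add_comm t]
  constructor
  · rintro ⟨σ, hσ, -, hp, h⟩
    have : σ = fun s => γ (a * s + t) :=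
      hσ.eq_of_velocityLift_eq (hγ.comp_affine a t) (h.trans h0.symm)
    rw [this] at hp
    exact hp
  · intro hp
    exact ⟨fun s => γ (a * s + t), hγ.comp_affine a t,
      fun s => (norm_velocity_comp_affine hγ.1 hv a t s).trans ha, hp, h0⟩

theorem direction_mem_minimizingDirections_iff (hγ : IsGeodesic E γ) (hv0 : 0 < v)
    (hv : ∀ t, ‖velocity E γ t‖ = v) (t : ℝ) (p : M) :
    direction E γ t ∈ minimizingDirections E (γ t) p ↔ γ (t + dist (γ t) p / v) = p := by
  have h := smul_velocity_mem_minimizingDirections_iff hγ hv (a := v⁻¹)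
    (by rw [abs_of_pos (inv_pos.2 hv0), inv_mul_cancel₀ hv0.ne']) t p
  rw [direction, hv, h, div_eq_inv_mul]

theorem neg_direction_mem_minimizingDirections_iff (hγ : IsGeodesic E γ) (hv0 : 0 < v)
    (hv : ∀ t, ‖velocity E γ t‖ = v) (t : ℝ) (p : M) :
    -direction E γ t ∈ minimizingDirections E (γ t) p ↔ γ (t - dist (γ t) p / v) = p := by
  have h := smul_velocity_mem_minimizingDirections_iff hγ hv (a := -v⁻¹)
    (by rw [abs_neg, abs_of_pos (inv_pos.2 hv0), inv_mul_cancel₀ hv0.ne']) t p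
  rw [direction, hv, ← neg_smul, h, div_eq_inv_mul, neg_mul, sub_eq_add_neg]

/-- Up to countably many times, a closed geodesic passes through the same point only at times that
differ by a period. -/
theorem IsGeodesic.countable_not_periodic (hγ : IsGeodesic E γ) (hv0 : 0 < v)
    (hv : ∀ t, ‖velocity E γ t‖ = v) :
    {t | ∃ s, γ t = γ s ∧ ¬ Function.Periodic γ (s - t)}.Countable := by
  refine (hγ.countable_transverse hγ hv0 hv hv).mono ?_
  rintro t ⟨s, h, hp⟩
  refine ⟨s, h, fun h' => hp fun x => ?_, hγ.not_reflection hv0 hv t s⟩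
  have := h' (x - t)
  rw [add_sub_cancel] at this
  rw [this]
  congr 1
  ring

end ClosedGeodesics

/-! ### `1/k`-geodesics and classes of balanced points -/

section Correspondence

variable {E : Type*} [NormedAddCommGroup E] [NormedSpace ℝ E] [FiniteDimensional ℝ E]
  {M : Type*} [MetricSpace M] [ChartedSpace E M] [IsManifold 𝓘(ℝ, E) ∞ M]
  [RiemannianBundle (fun x : M => TangentSpace 𝓘(ℝ, E) x)]
  [IsContMDiffRiemannianBundle 𝓘(ℝ, E) ∞ E (fun x : M => TangentSpace 𝓘(ℝ, E) x)]
  {k : ℕ} {γ σ : ℝ → M}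

/-- On a rotating geodesic of speed `v`, following the geodesic for the distance between consecutive
points of a tuple has the same effect as following it for the time `2π / k`: the two times differ by
a period, for all but countably many base points by the tangency of self-intersections, and for all
of them by continuity. -/
theorem IsRotatingGeodesic.periodic [NeZero k] (hγ : IsRotatingGeodesic E k γ) {v : ℝ} (hv0 : 0 < v)
    (hv : ∀ t, ‖velocity E γ t‖ = v) (t : ℝ) :
    Function.Periodic γ (dist (γ t) (γ (t + 2 * Real.pi / k)) / v - 2 * Real.pi / k) := by
  have hp := hγ.1.2.1
  have hcont := hγ.1.1.continuous
  set N := {t | ∃ s, γ t = γ s ∧ ¬ Function.Periodic γ (s - t)} with hN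
  have hNc : N.Countable := hγ.1.1.countable_not_periodic hv0 hv
  have hperiodic : ∀ {t s : ℝ}, t ∉ N → γ t = γ s → Function.Periodic γ (s - t) :=
    fun ht hs => by_contra fun h => ht ⟨_, hs, h⟩
  have hgen : ∀ t, t ∉ N → t + 2 * Real.pi / k ∉ N →
      Function.Periodic γ (dist (γ t) (γ (t + 2 * Real.pi / k)) / v - 2 * Real.pi / k) := by
    intro t ht ht'
    obtain ⟨-, s, hs, hdir⟩ := (hγ.2 t).2
    -- association holds at some time `s` with the same tuple, which may differ from `t`; but for
    -- generic `t` the difference is a period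
    obtain ⟨e0, e1⟩ := eq_and_eq_of_evenTuple_eq hp hp hs
    have h1 : γ (s + dist (γ s) (γ (s + 2 * Real.pi / k)) / v) = γ (s + 2 * Real.pi / k) := by
      have h2 := (hdir 0).1
      rw [evenTuple_one hp] at h2
      have h3 := (direction_mem_minimizingDirections_iff hγ.1.1 hv0 hv _ _).1 h2
      simpa using h3
    rw [← e0, ← e1] at h1
    have h4 := hperiodic ht e0 (t + dist (γ t) (γ (t + 2 * Real.pi / k)) / v)
    rw [show t + dist (γ t) (γ (t + 2 * Real.pi / k)) / v + (s - t)
      = s + dist (γ t) (γ (t + 2 * Real.pi / k)) / v by ring, h1] at h4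
    have h5 := hperiodic ht' h4
    rwa [add_sub_add_left_eq_sub] at h5
  have hclosed : IsClosed {t | Function.Periodic γ
      (dist (γ t) (γ (t + 2 * Real.pi / k)) / v - 2 * Real.pi / k)} := by
    simp only [Function.Periodic, ofPred_forall]
    exact isClosed_iInter fun x => isClosed_eq (by fun_prop) continuous_const
  have hcount : (N ∪ (fun t => t + 2 * Real.pi / k) ⁻¹' N).Countable :=
    hNc.union (hNc.preimage_of_injOn (add_left_injective _).injOn)
  refine hclosed.closure_subset_iff.2 ?_ ((hcount.dense_compl ℝ).closure_eq.symm ▸ mem_univ t)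
  intro t ht
  exact hgen t (fun h => ht (.inl h)) (fun h => ht (.inr h))

variable [IsRiemannianManifold 𝓘(ℝ, E) M]

theorem IsOneOverKGeodesic.exists_speed (hγ : IsOneOverKGeodesic E k γ) :
    ∃ v > 0, (∀ t, ‖velocity E γ t‖ = v) ∧
      ∀ t, dist (γ t) (γ (t + 2 * Real.pi / k)) = v * (2 * Real.pi / k) := by
  obtain ⟨v, hv0, hv⟩ := hγ.1.exists_speed
  refine ⟨v, hv0, hv, fun t => ?_⟩
  rw [hγ.2, closedLength_of_norm_velocity_eq hv]
  ring

variable [NeZero k]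

/-- A `1/k`-geodesic reaches the next point of the tuple exactly at the distance of the two points,
so its arcs between consecutive points are minimizing in both directions. -/
theorem IsOneOverKGeodesic.isRotatingGeodesic (hγ : IsOneOverKGeodesic E k γ) :
    IsRotatingGeodesic E k γ := by
  obtain ⟨v, hv0, hv, hd⟩ := hγ.exists_speed
  have hp := hγ.1.2.1
  have hd' : ∀ t, dist (γ t) (γ (t - 2 * Real.pi / k)) = v * (2 * Real.pi / k) := fun t => by
    rw [dist_comm, ← hd (t - 2 * Real.pi / k), sub_add_cancel]
  have hdir : ∀ (t : ℝ) (i : Fin k),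
      direction E γ (t + 2 * Real.pi * (i : ℕ) / k) ∈
        minimizingDirections E (evenTuple k γ t i) (evenTuple k γ t (i + 1)) ∧
      -direction E γ (t + 2 * Real.pi * (i : ℕ) / k) ∈
        minimizingDirections E (evenTuple k γ t i) (evenTuple k γ t (i - 1)) := by
    intro t i
    rw [evenTuple_succ hp, evenTuple_pred hp]
    refine ⟨(direction_mem_minimizingDirections_iff hγ.1.1 hv0 hv _ _).2 ?_,
      (neg_direction_mem_minimizingDirections_iff hγ.1.1 hv0 hv _ _).2 ?_⟩
    · rw [hd, mul_div_cancel_left₀ _ hv0.ne']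
    · rw [hd', mul_div_cancel_left₀ _ hv0.ne']
  refine ⟨hγ.1, fun t => ⟨⟨fun i => ?_, fun i => direction E γ (t + 2 * Real.pi * (i : ℕ) / k),
    hdir t⟩, hγ.1, t, rfl, hdir t⟩⟩
  rw [evenTuple_succ hp, evenTuple_pred hp, dist_comm]
  exact (hd' _).trans (hd _).symm

theorem IsOneOverKGeodesic.uniformEnergy_ne_zero (hγ : IsOneOverKGeodesic E k γ) (t : ℝ) :
    uniformEnergy (evenTuple k γ t) ≠ 0 := by
  obtain ⟨v, hv0, hv, hd⟩ := hγ.exists_speed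
  have hk : (k : ℝ) ≠ 0 := NeZero.ne _
  rw [uniformEnergy_evenTuple hγ.1.2.1 hd]
  have := Real.pi_pos
  positivity

/-- Every class of balanced points of nonzero energy comes from a `1/k`-geodesic. A rotating
geodesic need not be one itself: for example the `(k + 1)`-fold iterate of a `1/k`-geodesic has the
same evenly spaced tuples. Changing the speed so that consecutive points are joined by the
minimizing arcs gives the `1/k`-geodesic. -/
theorem IsRotatingGeodesic.exists_isOneOverKGeodesic (hγ : IsRotatingGeodesic E k γ)
    (hE : ∃ t, uniformEnergy (evenTuple k γ t) ≠ 0) :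
    ∃ σ : ℝ → M, IsOneOverKGeodesic E k σ ∧ tupleSet k σ = tupleSet k γ := by
  obtain ⟨v, hv0, hv⟩ := hγ.1.exists_speed
  have hcont := hγ.1.1.continuous
  have hk : (0 : ℝ) < k := Nat.cast_pos.2 (NeZero.pos k)
  have hpi := Real.pi_pos
  have hper := hγ.periodic hv0 hv
  set δ := dist (γ 0) (γ (0 + 2 * Real.pi / k)) / v with hδ
  have hconst : ∀ t, dist (γ t) (γ (t + 2 * Real.pi / k)) = v * δ := by
    intro t
    have := eq_of_continuous_of_periodic hv0 hv (by fun_prop) hper t 0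
    rw [sub_left_inj, ← hδ, div_eq_iff hv0.ne'] at this
    rw [this, mul_comm]
  have hP : Function.Periodic γ (δ - 2 * Real.pi / k) := hper 0
  have hδ0 : 0 < δ := by
    refine (div_nonneg dist_nonneg hv0.le).lt_of_ne' fun h0 => ?_
    obtain ⟨t, ht⟩ := hE
    apply ht
    rw [uniformEnergy_evenTuple hγ.1.2.1 hconst, hδ, h0]
    simp
  -- the distance along `γ` between consecutive points is `v * δ`; the curve which covers `k` such
  -- arcs in the time `2π` closes up, since `δ` and `2π / k` agree up to a period of `γ`
  set c := k * δ / (2 * Real.pi) with hc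
  have hc0 : 0 < c := by positivity
  have hck : ∀ x : ℝ, c * (2 * Real.pi * x / k) = δ * x := fun x => by
    rw [hc]
    field_simp
  have htuple : ∀ t, evenTuple k (fun s => γ (c * s + 0)) t = evenTuple k γ (c * t) := by
    intro t
    funext i
    simp only [evenTuple]
    rw [← hP.nat_mul (i : ℕ) (c * t + _), add_zero, mul_add, hck]
    congr 1
    ring
  have hspeed := norm_velocity_comp_affine hγ.1.1.1 hv c 0
  rw [abs_of_pos hc0] at hspeed
  refine ⟨fun s => γ (c * s + 0), ⟨⟨hγ.1.1.comp_affine c 0, fun t => ?_, ?_⟩, fun t => ?_⟩, ?_⟩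
  · have h1 : Function.Periodic γ (k * (δ - 2 * Real.pi / k) + 2 * Real.pi) :=
      (hP.nat_mul k).add_period hγ.1.2.1
    have h2 : c * (t + 2 * Real.pi) + 0
        = c * t + 0 + (k * (δ - 2 * Real.pi / k) + 2 * Real.pi) := by
      rw [hc]
      field_simp
      ring
    simp only [h2]
    exact h1 _
  · obtain ⟨s, t, hst⟩ := hγ.1.2.2
    refine ⟨s / c, t / c, ?_⟩
    simpa only [mul_div_cancel₀ _ hc0.ne', add_zero] using hst
  · have h1 : c * (t + 2 * Real.pi / k) + 0 = c * t + 2 * Real.pi / k + (δ - 2 * Real.pi / k) := by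
      have := hck 1
      rw [mul_one, mul_one] at this
      rw [mul_add, this]
      ring
    simp only [h1]
    rw [hP, add_zero, hconst, closedLength_of_norm_velocity_eq hspeed, hc]
    field_simp
  · refine Subset.antisymm ?_ ?_
    · rintro _ ⟨t, rfl⟩
      exact ⟨c * t, (htuple t).symm⟩
    · rintro _ ⟨t, rfl⟩
      exact ⟨t / c, by rw [htuple, mul_div_cancel₀ _ hc0.ne']⟩

/-- Two `1/k`-geodesics with the same evenly spaced tuples have the same speed, and at all but
countably many times they meet tangentially. A tangency with equal velocities is a change of base
point. If there is none, then `σ(s + x) = γ(t - x)` whenever the tuples of `γ` at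
`t` and of `σ` at `s` agree, for generic `t`, so `γ(t + 2π / k) = γ(t - 2π / k)` and `4π / k` is a
period of `γ`. -/
theorem IsOneOverKGeodesic.sameCurve (hγ : IsOneOverKGeodesic E k γ)
    (hσ : IsOneOverKGeodesic E k σ) (h : tupleSet k γ = tupleSet k σ) : SameCurve k γ σ := by
  obtain ⟨v, hv0, hv, hd⟩ := hγ.exists_speed
  obtain ⟨w, hw0, hw, hd'⟩ := hσ.exists_speed
  have hk : (0 : ℝ) < k := Nat.cast_pos.2 (NeZero.pos k)
  have htuple : ∀ t, ∃ s, γ t = σ s ∧ γ (t + 2 * Real.pi / k) = σ (s + 2 * Real.pi / k) := by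
    intro t
    obtain ⟨s, hs⟩ : evenTuple k γ t ∈ tupleSet k σ := h ▸ mem_range_self t
    exact ⟨s, eq_and_eq_of_evenTuple_eq hγ.1.2.1 hσ.1.2.1 hs.symm⟩
  have hvw : v = w := by
    obtain ⟨s, e0, e1⟩ := htuple 0
    have h1 := hd 0
    rw [e0, e1, hd'] at h1
    have := Real.pi_pos
    exact (mul_right_cancel₀ (by positivity) h1).symm
  subst hvw
  by_cases hshift : ∃ t s, ∀ x, γ (t + x) = σ (s + x)
  · obtain ⟨t, s, hts⟩ := hshift
    refine .inl ⟨t - s, fun x => ?_⟩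
    rw [show x + (t - s) = t + (x - s) by ring, hts]
    congr 1
    ring
  · push Not at hshift
    have hcount := hγ.1.1.countable_transverse hσ.1.1 hv0 hv hw
    have hdense := hcount.dense_compl ℝ
    have hrefl : ∀ t ∈ {t | ∃ s, γ t = σ s ∧ (¬ ∀ x, γ (t + x) = σ (s + x)) ∧
        ¬ ∀ x, γ (t + x) = σ (s - x)}ᶜ, ∃ s, (∀ x, γ (t + x) = σ (s - x)) ∧
          γ (t + 2 * Real.pi / k) = σ (s + 2 * Real.pi / k) := by
      intro t ht
      obtain ⟨s, e0, e1⟩ := htuple t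
      refine ⟨s, by_contra fun hx => ht ⟨s, e0, fun hx' => ?_, hx⟩, e1⟩
      obtain ⟨x, hx''⟩ := hshift t s
      exact hx'' (hx' x)
    obtain ⟨t₀, ht₀⟩ := hdense.nonempty
    obtain ⟨s₀, hs₀, -⟩ := hrefl t₀ ht₀
    -- the tuples agree and the time is reflected, so the successor and the predecessor of `γ t`
    -- both are `σ (s + 2π / k)`
    have hall : ∀ t, γ (t + 2 * Real.pi / k) = γ (t - 2 * Real.pi / k) := by
      have hcont := hγ.1.1.continuous
      refine congrFun (Continuous.ext_on hdense (f := fun t => γ (t + 2 * Real.pi / k))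
        (g := fun t => γ (t - 2 * Real.pi / k)) (by fun_prop) (by fun_prop) fun t ht => ?_)
      obtain ⟨s, h1, h2⟩ := hrefl t ht
      simp only
      rw [h2, sub_eq_add_neg, h1, sub_neg_eq_add]
    refine .inr ⟨fun t => ?_, t₀ + s₀, fun x => ?_⟩
    · have := hall (t + 2 * Real.pi / k)
      rw [add_sub_cancel_right] at this
      rw [← this]
      congr 1
      ring
    · rw [add_sub_assoc, hs₀, sub_sub_cancel]

end Correspondence

theorem mainTheorem1 {E : Type*} [NormedAddCommGroup E] [NormedSpace ℝ E] [FiniteDimensional ℝ E]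
    {M : Type*} [MetricSpace M] [CompactSpace M] [ChartedSpace E M] [IsManifold 𝓘(ℝ, E) ∞ M]
    [RiemannianBundle (fun x : M => TangentSpace 𝓘(ℝ, E) x)]
    [IsContMDiffRiemannianBundle 𝓘(ℝ, E) ∞ E (fun x : M => TangentSpace 𝓘(ℝ, E) x)]
    [IsRiemannianManifold 𝓘(ℝ, E) M] (k : ℕ) [NeZero k] :
    (∀ γ : ℝ → M, IsOneOverKGeodesic E k γ → IsRotatingGeodesic E k γ) ∧
    Set.BijOn (curveTupleSet k (M := M))
      {c | ∃ γ : ℝ → M, IsOneOverKGeodesic E k γ ∧ Quotient.mk (curveSetoid k M) γ = c}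
      {A | IsBalancedClass E k A ∧ ∀ x ∈ A, uniformEnergy x ≠ 0} := by
  refine ⟨fun γ hγ => hγ.isRotatingGeodesic, ?_, ?_, ?_⟩
  · rintro _ ⟨γ, hγ, rfl⟩
    refine ⟨⟨γ, hγ.isRotatingGeodesic, rfl⟩, ?_⟩
    rintro _ ⟨t, rfl⟩
    exact hγ.uniformEnergy_ne_zero t
  · rintro _ ⟨γ, hγ, rfl⟩ _ ⟨σ, hσ, rfl⟩ h
    exact Quotient.sound (hγ.sameCurve hσ h)
  · rintro _ ⟨⟨γ, hγ, rfl⟩, hE⟩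
    obtain ⟨σ, hσ, h⟩ := hγ.exists_isOneOverKGeodesic ⟨0, hE _ ⟨0, rfl⟩⟩
    exact ⟨Quotient.mk (curveSetoid k M) σ, ⟨σ, hσ, rfl⟩, h⟩
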